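/- Let $\mathscr P$ be the set of probability distributions on $\mathbf R$ (identified with their cumulative distribution functions $F$), endowed with the topology of weak convergence. For $F,G\in\mathscr P$ let $F\,\circledast G\in\mathscr P$ be the free max-convolution, that is, the distribution given by $$(F\,\circledast G)(x)=\max\{0,\,F(x)+G(x)-1\}\qquad (x\in\mathbf R),$$ and for $n\ge 1$ let $F^{\circledast n}$ be the $n$-fold free max-convolution of $F$ with itself (so $F^{\circledast 1}=F$). Let $\mathsf D^{\mathrm{free}}$, the maximum free domain of attraction, be the set of all $F\in\mathscr P$ for which there exist real numbers $a_n>0$ and $b_n$ ($n\ge 1$) and a nondegenerate distribution $G\in\mathscr P$ (that is, $G$ is not a point mass) such that $$\lim_{n\to\infty}F^{\circledast n}(a_nx+b_n)=G(x)\qquad\text{for every continuity point } x\in\mathbf R \text{ of } G.$$ Then $\mathsf D^{\mathrm{free}}$ is dense and of the first Baire category (meager) in $\mathscr P$. -/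

import Mathlib

open MeasureTheory ProbabilityTheory Filter Set
open scoped Topology

/-- The function `x ↦ max {0, F x + G x - 1}`, where `F` and `G` are the distribution functions of
two laws on the line, as a right-continuous monotone function. -/
noncomputable def freeMaxStieltjes (μ ν : ProbabilityMeasure ℝ) : StieltjesFunction ℝ where
  toFun x := max 0 (cdf (μ : Measure ℝ) x + cdf (ν : Measure ℝ) x - 1)
  mono' _ _ hxy := max_le_max le_rfl
    (sub_le_sub_right (add_le_add (monotone_cdf _ hxy) (monotone_cdf _ hxy)) 1)
  right_continuous' x := continuousWithinAt_const.max
    ((((cdf (μ : Measure ℝ)).right_continuous x).add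
      ((cdf (ν : Measure ℝ)).right_continuous x)).sub continuousWithinAt_const)

theorem tendsto_freeMaxStieltjes_atBot (μ ν : ProbabilityMeasure ℝ) :
    Tendsto (freeMaxStieltjes μ ν) atBot (𝓝 0) := by
  have h := (tendsto_const_nhds (x := (0 : ℝ))).max
    (((tendsto_cdf_atBot (μ : Measure ℝ)).add (tendsto_cdf_atBot (ν : Measure ℝ))).sub
      (tendsto_const_nhds (x := (1 : ℝ))))
  have e : max (0 : ℝ) (0 + 0 - 1) = 0 := by norm_num
  rw [e] at h
  exact h

theorem tendsto_freeMaxStieltjes_atTop (μ ν : ProbabilityMeasure ℝ) :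
    Tendsto (freeMaxStieltjes μ ν) atTop (𝓝 1) := by
  have h := (tendsto_const_nhds (x := (0 : ℝ))).max
    (((tendsto_cdf_atTop (μ : Measure ℝ)).add (tendsto_cdf_atTop (ν : Measure ℝ))).sub
      (tendsto_const_nhds (x := (1 : ℝ))))
  have e : max (0 : ℝ) (1 + 1 - 1) = 1 := by norm_num
  rw [e] at h
  exact h

/-- The free max-convolution of two laws on the line: the law whose distribution function is
`x ↦ max {0, F x + G x - 1}`. -/
noncomputable def freeMaxConv (μ ν : ProbabilityMeasure ℝ) : ProbabilityMeasure ℝ :=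
  ⟨(freeMaxStieltjes μ ν).measure,
    (freeMaxStieltjes μ ν).isProbabilityMeasure
      (tendsto_freeMaxStieltjes_atBot μ ν) (tendsto_freeMaxStieltjes_atTop μ ν)⟩

theorem cdf_freeMaxConv (μ ν : ProbabilityMeasure ℝ) (x : ℝ) :
    cdf (freeMaxConv μ ν : Measure ℝ) x =
      max 0 (cdf (μ : Measure ℝ) x + cdf (ν : Measure ℝ) x - 1) := by
  have h : cdf (freeMaxConv μ ν : Measure ℝ) = freeMaxStieltjes μ ν :=
    cdf_measure_stieltjesFunction _
      (tendsto_freeMaxStieltjes_atBot μ ν) (tendsto_freeMaxStieltjes_atTop μ ν)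
  rw [h]
  rfl

/-- The `n`-fold free max-convolution of `μ` with itself, for `n ≥ 1`; the value at `n = 0` is
arbitrary. -/
noncomputable def freeMaxPow (μ : ProbabilityMeasure ℝ) : ℕ → ProbabilityMeasure ℝ
  | 0 => μ
  | 1 => μ
  | n + 2 => freeMaxConv (freeMaxPow μ (n + 1)) μ

/-- A law on the line is nondegenerate if it is not a point mass. -/
def IsNondegenerateLaw (ν : ProbabilityMeasure ℝ) : Prop :=
  ∀ c : ℝ, (ν : Measure ℝ) ≠ Measure.dirac c

/-- The maximum free domain of attraction: the laws whose `n`-fold free max-convolution powers,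
after an affine normalisation with positive slopes, converge in distribution to some nondegenerate
law. -/
def freeMaxDomain : Set (ProbabilityMeasure ℝ) :=
  {μ | ∃ (a b : ℕ → ℝ) (ν : ProbabilityMeasure ℝ),
    (∀ n, 1 ≤ n → 0 < a n) ∧ IsNondegenerateLaw ν ∧
    ∀ x : ℝ, ContinuousAt (cdf (ν : Measure ℝ)) x →
      Tendsto (fun n : ℕ => cdf (freeMaxPow μ n : Measure ℝ) (a n * x + b n)) atTop
        (𝓝 (cdf (ν : Measure ℝ) x))}

/-! ### Distribution functions of free max-convolution powers -/

/-! The powers have the closed form `max 0 (1 - n (1 - F))`, by induction, since a clamped value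
stays clamped. So membership in the domain depends only on how the tail `1 - F` behaves at heights
of order `1 / n`, and an arbitrarily small mass placed far to the right decides it.

Density: truncate at `m` and add a small uniform mass on `(m, m + 1]`. The tail is then linear near
the right endpoint, and the rescaled powers converge to a uniform law.

Meagreness: convergence to a nondegenerate `G` makes the scale `a n` control both the drop of the
tail from `1 / n` to a fixed fraction of it and the further drop to half that fraction, so the two
lengths have bounded ratio for large `n`. Laws that violate the bound `k` at some `N ≥ k` form an
open dense set `tailGapLaws (j + 1) k`, and each law of the domain misses one of these countably
many sets. -/

theorem cdf_freeMaxPow (μ : ProbabilityMeasure ℝ) (n : ℕ) (hn : 1 ≤ n) (x : ℝ) :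
    cdf (freeMaxPow μ n : Measure ℝ) x = max 0 (1 - n * (1 - cdf (μ : Measure ℝ) x)) := by
  induction n, hn using Nat.le_induction with
  | base =>
    have := cdf_nonneg (μ : Measure ℝ) x
    simp [freeMaxPow, this]
  | succ n hn ih =>
    obtain ⟨m, rfl⟩ := Nat.exists_eq_add_of_le' hn
    have h1 := cdf_le_one (μ : Measure ℝ) x
    rw [freeMaxPow, cdf_freeMaxConv, ih]
    push_cast
    rcases le_total (1 - ((m : ℝ) + 1) * (1 - cdf (μ : Measure ℝ) x)) 0 with h | h
    · rw [max_eq_left h, max_eq_left (by linarith), max_eq_left (by linarith)]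
    · rw [max_eq_right h]
      congr 1
      ring

theorem one_sub_cdf_eq_real_Ioi (μ : ProbabilityMeasure ℝ) (x : ℝ) :
    1 - cdf (μ : Measure ℝ) x = (μ : Measure ℝ).real (Ioi x) := by
  rw [cdf_eq_real, ← probReal_compl_eq_one_sub measurableSet_Iic, compl_Iic]

/-! ### Nondegenerate laws -/

/-- A distribution function with values in `{0, 1}` jumps once, at the infimum of `{F = 1}`, and so
belongs to a point mass. -/
theorem IsNondegenerateLaw.exists_cdf_mem_Ioo {ν : ProbabilityMeasure ℝ}
    (hν : IsNondegenerateLaw ν) : ∃ x, cdf (ν : Measure ℝ) x ∈ Ioo 0 1 := by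
  by_contra! hcon
  set F := cdf (ν : Measure ℝ) with hF
  have hval : ∀ x, F x = 0 ∨ F x = 1 := by
    intro x
    by_contra! h
    exact hcon x ⟨lt_of_le_of_ne (cdf_nonneg _ x) h.1.symm, lt_of_le_of_ne (cdf_le_one _ x) h.2⟩
  obtain ⟨t, ht⟩ := ((tendsto_cdf_atTop (ν : Measure ℝ)).eventually_const_lt zero_lt_one).exists
  obtain ⟨s, hs⟩ := ((tendsto_cdf_atBot (ν : Measure ℝ)).eventually_lt_const zero_lt_one).exists
  have hne : {x | F x = 1}.Nonempty := ⟨t, (hval t).resolve_left ht.ne'⟩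
  have hbdd : BddBelow {x | F x = 1} := by
    refine ⟨s, fun x hx => ?_⟩
    by_contra! h
    have := monotone_cdf (ν : Measure ℝ) h.le
    rw [← hF, show F x = 1 from hx] at this
    exact absurd hs (not_lt.2 this)
  set c := sInf {x | F x = 1}
  have hlt : ∀ x, x < c → F x = 0 := fun x hx =>
    (hval x).resolve_right fun h => absurd (csInf_le hbdd h) (not_le.2 hx)
  have hgt : ∀ x, c < x → F x = 1 := by
    intro x hx
    obtain ⟨y, hy, hyx⟩ := exists_lt_of_csInf_lt hne hx
    exact le_antisymm (cdf_le_one _ x) (le_of_eq_of_le hy.symm (monotone_cdf _ hyx.le))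
  have hcc : F c = 1 := by
    have h1 : Tendsto F (𝓝[>] c) (𝓝 (F c)) :=
      (F.right_continuous c).mono_left (nhdsWithin_mono _ Ioi_subset_Ici_self)
    exact tendsto_nhds_unique h1 <| tendsto_const_nhds.congr' <|
      eventually_nhdsWithin_of_forall fun x hx => (hgt x hx).symm
  refine hν c (Measure.eq_of_cdf _ _ ?_)
  ext x
  change F x = _
  rw [cdf_eq_real (Measure.dirac c), measureReal_def, Measure.dirac_apply' _ measurableSet_Iic]
  rcases lt_trichotomy x c with h | rfl | h
  · simp [hlt x h, h]
  · simp [hcc]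
  · simp [hgt x h, h.le]

theorem exists_continuousAt_cdf_mem {s : Set ℝ} (hs : IsOpen s) (hne : s.Nonempty)
    (ν : ProbabilityMeasure ℝ) : ∃ x ∈ s, ContinuousAt (cdf (ν : Measure ℝ)) x := by
  have hd := (monotone_cdf (ν : Measure ℝ)).countable_not_continuousAt.dense_compl ℝ
  obtain ⟨x, hx, hx'⟩ := hd.inter_open_nonempty s hs hne
  exact ⟨x, hx, not_not.1 hx'⟩

/-! ### Mixtures of laws -/

/-- The mixture `(1 - p) μ + p ν` of two laws. -/
noncomputable def lawMixture (p : unitInterval) (μ ν : ProbabilityMeasure ℝ) :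
    ProbabilityMeasure ℝ :=
  ⟨ENNReal.ofReal (1 - p) • (μ : Measure ℝ) + ENNReal.ofReal p • (ν : Measure ℝ), ⟨by
    simp only [Measure.add_apply, Measure.smul_apply, measure_univ, smul_eq_mul, mul_one]
    rw [← ENNReal.ofReal_add (sub_nonneg.2 p.2.2) p.2.1, sub_add_cancel, ENNReal.ofReal_one]⟩⟩

theorem lawMixture_real (p : unitInterval) (μ ν : ProbabilityMeasure ℝ) (s : Set ℝ) :
    (lawMixture p μ ν : Measure ℝ).real s =
      (1 - p) * (μ : Measure ℝ).real s + p * (ν : Measure ℝ).real s := by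
  change (ENNReal.ofReal (1 - p) • (μ : Measure ℝ) + ENNReal.ofReal p • (ν : Measure ℝ)).real s = _
  have h1 : IsFiniteMeasure (ENNReal.ofReal (1 - p) • (μ : Measure ℝ)) :=
    Measure.smul_finite _ ENNReal.ofReal_ne_top
  have h2 : IsFiniteMeasure (ENNReal.ofReal p • (ν : Measure ℝ)) :=
    Measure.smul_finite _ ENNReal.ofReal_ne_top
  rw [measureReal_add_apply, measureReal_ennreal_smul_apply, measureReal_ennreal_smul_apply,
    ENNReal.toReal_ofReal (sub_nonneg.2 p.2.2), ENNReal.toReal_ofReal p.2.1]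

theorem integral_lawMixture (p : unitInterval) (μ ν : ProbabilityMeasure ℝ)
    (f : BoundedContinuousFunction ℝ ℝ) :
    ∫ x, f x ∂(lawMixture p μ ν : Measure ℝ) =
      (1 - p) * ∫ x, f x ∂(μ : Measure ℝ) + p * ∫ x, f x ∂(ν : Measure ℝ) := by
  change ∫ x, f x ∂(ENNReal.ofReal (1 - p) • (μ : Measure ℝ) +
    ENNReal.ofReal p • (ν : Measure ℝ)) = _
  rw [integral_add_measure ((f.integrable _).smul_measure ENNReal.ofReal_ne_top)
      ((f.integrable _).smul_measure ENNReal.ofReal_ne_top),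
    integral_smul_measure, integral_smul_measure,
    ENNReal.toReal_ofReal (sub_nonneg.2 p.2.2), ENNReal.toReal_ofReal p.2.1, smul_eq_mul,
    smul_eq_mul]

/-- The laws `ν m` are arbitrary: their integrals of `f` are bounded by `‖f‖`, so a vanishing weight
suffices even if their mass escapes to infinity. -/
theorem tendsto_lawMixture {p : ℕ → unitInterval} (hp : Tendsto (fun m => (p m : ℝ)) atTop (𝓝 0))
    {μ : ProbabilityMeasure ℝ} {μs : ℕ → ProbabilityMeasure ℝ} (hμ : Tendsto μs atTop (𝓝 μ))
    (ν : ℕ → ProbabilityMeasure ℝ) :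
    Tendsto (fun m => lawMixture (p m) (μs m) (ν m)) atTop (𝓝 μ) := by
  rw [ProbabilityMeasure.tendsto_iff_forall_integral_tendsto] at hμ ⊢
  intro f
  have hb : Tendsto (fun m => (p m : ℝ) * ∫ x, f x ∂(ν m : Measure ℝ)) atTop (𝓝 0) := by
    refine hp.zero_mul_isBoundedUnder_le ?_
    refine isBoundedUnder_of ⟨‖f‖, fun m => ?_⟩
    exact f.norm_integral_le_norm (ν m : Measure ℝ)
  have h := (((tendsto_const_nhds (x := (1 : ℝ))).sub hp).mul (hμ f)).add hb
  simp only [sub_zero, one_mul, add_zero] at h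
  simpa only [integral_lawMixture] using h

/-! ### Truncation from above -/

/-- The law of `min X m`, where `X` has law `μ`. -/
noncomputable def truncateLaw (μ : ProbabilityMeasure ℝ) (m : ℝ) : ProbabilityMeasure ℝ :=
  μ.map (f := fun x => min x m) (by fun_prop)

theorem truncateLaw_real_of_Iic_subset (μ : ProbabilityMeasure ℝ) {m : ℝ} {s : Set ℝ}
    (hs : MeasurableSet s) (h : Iic m ⊆ s) : (truncateLaw μ m : Measure ℝ).real s = 1 := by
  rw [truncateLaw, ProbabilityMeasure.toMeasure_map, map_measureReal_apply (by fun_prop) hs,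
    eq_univ_of_forall (s := (fun x => min x m) ⁻¹' s) fun x => h (min_le_right x m), probReal_univ]

theorem truncateLaw_real_Ioi (μ : ProbabilityMeasure ℝ) {m x : ℝ} (h : m ≤ x) :
    (truncateLaw μ m : Measure ℝ).real (Ioi x) = 0 := by
  rw [← one_sub_cdf_eq_real_Ioi, cdf_eq_real,
    truncateLaw_real_of_Iic_subset μ measurableSet_Iic (Iic_subset_Iic.2 h), sub_self]

theorem tendsto_truncateLaw (μ : ProbabilityMeasure ℝ) :
    Tendsto (fun m : ℕ => truncateLaw μ m) atTop (𝓝 μ) := by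
  rw [ProbabilityMeasure.tendsto_iff_forall_integral_tendsto]
  intro f
  have he : ∀ m : ℕ, ∫ x, f x ∂(truncateLaw μ m : Measure ℝ) =
      ∫ x, f (min x m) ∂(μ : Measure ℝ) := fun m => by
    rw [truncateLaw, ProbabilityMeasure.toMeasure_map,
      integral_map (by fun_prop) f.continuous.aestronglyMeasurable]
  simp only [he]
  refine tendsto_integral_of_dominated_convergence (fun _ => ‖f‖)
    (fun m => (by fun_prop : Continuous fun x => f (min x m)).aestronglyMeasurable)
    (integrable_const _) (fun m => ae_of_all _ fun x => f.norm_coe_le_norm _)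
    (ae_of_all _ fun x => ?_)
  refine tendsto_const_nhds.congr' ?_
  obtain ⟨k, hk⟩ := exists_nat_ge x
  filter_upwards [eventually_ge_atTop k] with m hm
  rw [min_eq_left (hk.trans (Nat.cast_le.2 hm))]

/-! ### Density of the domain of attraction -/

/-- The uniform law on an interval of length one. -/
noncomputable def uniformUnitLaw (a : ℝ) : ProbabilityMeasure ℝ :=
  ⟨volume.restrict (Ioc a (a + 1)), ⟨by simp⟩⟩

theorem uniformUnitLaw_real_Ioi (a x : ℝ) :
    (uniformUnitLaw a : Measure ℝ).real (Ioi x) = max 0 (a + 1 - max x a) := by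
  change (volume.restrict (Ioc a (a + 1))).real (Ioi x) = _
  rw [measureReal_restrict_apply measurableSet_Ioi, inter_comm, Ioc_inter_Ioi, measureReal_def,
    Real.volume_Ioc, ENNReal.toReal_ofReal', max_comm 0, max_comm x]

theorem isNondegenerateLaw_uniformUnitLaw (a : ℝ) : IsNondegenerateLaw (uniformUnitLaw a) := by
  intro c h
  have h1 : (uniformUnitLaw a : Measure ℝ) {c} = 0 := by
    change (volume.restrict (Ioc a (a + 1))) {c} = 0
    simp
  simp [h] at h1

theorem lawMixture_uniformUnitLaw_mem_freeMaxDomain {p : unitInterval} (hp : 0 < p)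
    (μ : ProbabilityMeasure ℝ) (m : ℝ) :
    lawMixture p (truncateLaw μ m) (uniformUnitLaw m) ∈ freeMaxDomain := by
  have hp' : (0 : ℝ) < p := hp
  refine ⟨fun n => 1 / (n * p), fun _ => m + 1, uniformUnitLaw (-1), fun n hn => by positivity,
    isNondegenerateLaw_uniformUnitLaw _, fun x _ => ?_⟩
  -- For fixed `x` the sequence is eventually constant: once `n * p ≥ -x`, the rescaled point lies
  -- above `m`, where only the uniform part has a tail.
  refine tendsto_const_nhds.congr' ?_
  obtain ⟨k, hk⟩ := exists_nat_ge (-x / p)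
  filter_upwards [eventually_ge_atTop k, eventually_ge_atTop 1] with n hkn hn
  have hn0 : (0 : ℝ) < n := by exact_mod_cast hn
  have hnp : 0 < n * (p : ℝ) := by positivity
  have hx : -x ≤ n * p := (div_le_iff₀ hp').1 (hk.trans (Nat.cast_le.2 hkn))
  have hxm : m ≤ 1 / (n * p) * x + (m + 1) := by
    have : -1 ≤ 1 / (n * (p : ℝ)) * x := by
      rw [one_div_mul_eq_div, le_div_iff₀ hnp]
      linarith
    linarith
  rw [cdf_freeMaxPow _ _ hn, one_sub_cdf_eq_real_Ioi, lawMixture_real,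
    truncateLaw_real_Ioi μ hxm, uniformUnitLaw_real_Ioi, max_eq_left hxm, mul_zero, zero_add]
  have hu := one_sub_cdf_eq_real_Ioi (uniformUnitLaw (-1)) x
  rw [uniformUnitLaw_real_Ioi] at hu
  have hmax : (n : ℝ) * (p * max 0 (m + 1 - (1 / (n * p) * x + (m + 1)))) = max 0 (-x) := by
    rw [← mul_assoc, mul_max_of_nonneg _ _ hnp.le, mul_zero]
    congr 1
    field_simp
    ring
  rw [hmax, eq_sub_of_add_eq' (sub_eq_iff_eq_add.1 hu).symm]
  -- Both sides are `1 + x` clamped to `[0, 1]`.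
  grind

theorem dense_freeMaxDomain : Dense freeMaxDomain := by
  intro μ
  let p : ℕ → unitInterval := fun m => ⟨1 / ((m : ℝ) + 1), by positivity, by
    rw [div_le_one (by positivity)]
    linarith [(Nat.cast_nonneg m : (0 : ℝ) ≤ m)]⟩
  have hp : Tendsto (fun m => (p m : ℝ)) atTop (𝓝 0) := tendsto_one_div_add_atTop_nhds_zero_nat
  refine mem_closure_of_tendsto
    (tendsto_lawMixture hp (tendsto_truncateLaw μ) fun m => uniformUnitLaw m)
    (Eventually.of_forall fun m => lawMixture_uniformUnitLaw_mem_freeMaxDomain ?_ μ m)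
  exact (by positivity : (0 : ℝ) < 1 / ((m : ℝ) + 1))

/-! ### Laws with a cluster in the tail followed by a long gap -/

/-- Laws for which, for some large `N`, the tail probability falls from above `1 / N` to below
`1 / (j * N)` on an interval `(u, w)`, and stays above `1 / (2 * j * N)` up to a point `v` whose
distance from `w` exceeds `k` times the length of the interval. -/
def tailGapLaws (j k : ℕ) : Set (ProbabilityMeasure ℝ) :=
  {μ | ∃ N : ℕ, k ≤ N ∧ 1 ≤ N ∧ ∃ u w v : ℝ, k * (w - u) < v - w ∧
    1 / (N : ℝ) < (μ : Measure ℝ).real (Ioi u) ∧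
    1 - 1 / (j * N : ℝ) < (μ : Measure ℝ).real (Iio w) ∧
    1 / (2 * j * N : ℝ) < (μ : Measure ℝ).real (Ioi v)}

theorem eventually_lt_measureReal_of_isOpen {μ : ProbabilityMeasure ℝ} {s : Set ℝ} (hs : IsOpen s)
    {c : ℝ} (h : c < (μ : Measure ℝ).real s) :
    ∀ᶠ ν : ProbabilityMeasure ℝ in 𝓝 μ, c < (ν : Measure ℝ).real s := by
  rcases lt_or_ge c 0 with hc | hc
  · exact Eventually.of_forall fun ν => hc.trans_le measureReal_nonneg
  have h' : ENNReal.ofReal c < (μ : Measure ℝ) s :=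
    (ENNReal.ofReal_lt_iff_lt_toReal hc (measure_ne_top _ _)).2 h
  have hl := ProbabilityMeasure.le_liminf_measure_open_of_tendsto (tendsto_id (x := 𝓝 μ)) hs
  filter_upwards [eventually_lt_of_lt_liminf (h'.trans_le hl)] with ν hν
  exact (ENNReal.ofReal_lt_iff_lt_toReal hc (measure_ne_top _ _)).1 hν

/-- Each condition is a strict lower bound on the mass of an open half-line, hence open by the
portmanteau theorem; this is why the upper bound on the tail is phrased through `Iio w`. -/
theorem isOpen_tailGapLaws (j k : ℕ) : IsOpen (tailGapLaws j k) := by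
  rw [isOpen_iff_mem_nhds]
  rintro μ ⟨N, hkN, hN, u, w, v, huwv, hu, hw, hv⟩
  filter_upwards [eventually_lt_measureReal_of_isOpen isOpen_Ioi hu,
    eventually_lt_measureReal_of_isOpen isOpen_Iio hw,
    eventually_lt_measureReal_of_isOpen isOpen_Ioi hv] with ν hu' hw' hv'
  exact ⟨N, hkN, hN, u, w, v, huwv, hu', hw', hv'⟩

/-- The point mass as a bundled law. -/
noncomputable def diracLaw (c : ℝ) : ProbabilityMeasure ℝ :=
  ⟨Measure.dirac c, inferInstance⟩

theorem diracLaw_real_of_mem {c : ℝ} {s : Set ℝ} (h : c ∈ s) :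
    (diracLaw c : Measure ℝ).real s = 1 := by
  change (Measure.dirac c).real s = 1
  rw [measureReal_def, Measure.dirac_apply_of_mem h, ENNReal.toReal_one]

theorem lawMixture_dirac_mem_tailGapLaws (μ : ProbabilityMeasure ℝ) {j k N : ℕ} (hkN : k ≤ N)
    (hN : 1 ≤ N) (m : ℝ) {p q : unitInterval} (hp : (p : ℝ) = 2 / (N + 1))
    (hq : (q : ℝ) = 3 / (8 * (j + 1))) :
    lawMixture p (truncateLaw μ m)
      (lawMixture q (diracLaw (m + 1)) (diracLaw (m + 2 * k + 4))) ∈ tailGapLaws (j + 1) k := by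
  have hk : (0 : ℝ) ≤ k := Nat.cast_nonneg k
  have hj : (0 : ℝ) ≤ j := Nat.cast_nonneg j
  have hpq : (p : ℝ) * q = 3 / (4 * (j + 1) * (N + 1)) := by
    rw [hp, hq]
    field_simp
    norm_num
  have hp0 := p.2.1
  -- The tail is `p = 2 / (N + 1)` at `u` and `p * q` from `w` to `v`, where `p * q` is `3 / 4` of
  -- `1 / ((j + 1) * (N + 1))`, strictly between the two required bounds. The lengths are `w - u =
  -- 2` and `v - w = 2 * k + 1`.
  refine ⟨N + 1, by lia, by lia, m, m + 2, m + 2 * k + 3, by linarith, ?_, ?_, ?_⟩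
  · rw [lawMixture_real, truncateLaw_real_Ioi μ le_rfl, lawMixture_real,
      diracLaw_real_of_mem (by simp), diracLaw_real_of_mem (by simp; linarith), hp]
    push_cast
    rw [mul_zero, zero_add, mul_one, mul_one, sub_add_cancel, mul_one]
    gcongr
    norm_num
  · rw [lawMixture_real, truncateLaw_real_of_Iic_subset μ measurableSet_Iio
      (Iic_subset_Iio.2 (by linarith)), lawMixture_real, diracLaw_real_of_mem (by simp)]
    have h0 : (0 : ℝ) ≤ p * (q * (diracLaw (m + 2 * k + 4) : Measure ℝ).real (Iio (m + 2))) := by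
      have := q.2.1
      positivity
    have h1 : (p : ℝ) * q < 1 / ((j + 1) * (N + 1)) := by
      rw [hpq, div_lt_div_iff₀ (by positivity) (by positivity)]
      nlinarith [(by positivity : (0 : ℝ) < ((j : ℝ) + 1) * (N + 1))]
    push_cast
    linarith
  · rw [lawMixture_real, lawMixture_real, truncateLaw_real_Ioi μ (by linarith),
      diracLaw_real_of_mem (c := m + 2 * k + 4) (by norm_num)]
    have h0 : (0 : ℝ) ≤ p * ((1 - q) * (diracLaw (m + 1) : Measure ℝ).real
        (Ioi (m + 2 * k + 3))) := by
      have := sub_nonneg.2 q.2.2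
      positivity
    have h1 : 1 / (2 * (j + 1) * (N + 1)) < (p : ℝ) * q := by
      rw [hpq, div_lt_div_iff₀ (by positivity) (by positivity)]
      nlinarith [(by positivity : (0 : ℝ) < ((j : ℝ) + 1) * (N + 1))]
    push_cast
    linarith

theorem dense_tailGapLaws (j k : ℕ) : Dense (tailGapLaws (j + 1) k) := by
  intro μ
  let p : ℕ → unitInterval := fun m => ⟨2 / (((m + k + 1 : ℕ) : ℝ) + 1), by positivity, by
    rw [div_le_one (by positivity)]
    push_cast
    linarith [(Nat.cast_nonneg m : (0 : ℝ) ≤ m), (Nat.cast_nonneg k : (0 : ℝ) ≤ k)]⟩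
  let q : unitInterval := ⟨3 / (8 * ((j : ℝ) + 1)), by positivity, by
    rw [div_le_one (by positivity)]
    linarith [(Nat.cast_nonneg j : (0 : ℝ) ≤ j)]⟩
  have hp : Tendsto (fun m => (p m : ℝ)) atTop (𝓝 0) := by
    refine Tendsto.div_atTop tendsto_const_nhds (tendsto_atTop_add_const_right _ _ ?_)
    exact tendsto_natCast_atTop_atTop.comp
      (tendsto_atTop_mono (fun m => by simp only [id]; lia) tendsto_id)
  exact mem_closure_of_tendsto (tendsto_lawMixture hp (tendsto_truncateLaw μ)
      fun m => lawMixture q (diracLaw (m + 1)) (diracLaw (m + 2 * k + 4)))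
    (Eventually.of_forall fun m =>
      lawMixture_dirac_mem_tailGapLaws μ (by lia) (by lia) m rfl rfl)

/-! ### Meagreness of the domain of attraction -/

theorem exists_notMem_tailGapLaws {μ : ProbabilityMeasure ℝ} (hμ : μ ∈ freeMaxDomain) :
    ∃ j k : ℕ, μ ∉ tailGapLaws (j + 1) k := by
  obtain ⟨a, b, ν, ha, hν, hlim⟩ := hμ
  obtain ⟨x₀, hx₀, hx₀'⟩ := hν.exists_cdf_mem_Ioo
  obtain ⟨z, hx₀z, hz⟩ : ∃ z, x₀ < z ∧ ∀ x ∈ Ioo x₀ z, cdf (ν : Measure ℝ) x < 1 := by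
    have h : ∀ᶠ x in 𝓝[>] x₀, cdf (ν : Measure ℝ) x < 1 :=
      (((cdf (ν : Measure ℝ)).right_continuous x₀).mono_left
        (nhdsWithin_mono _ Ioi_subset_Ici_self)).eventually_lt_const hx₀'
    obtain ⟨z, hz, hz'⟩ := mem_nhdsGT_iff_exists_Ioo_subset.1 h
    exact ⟨z, hz, fun x hx => hz' hx⟩
  obtain ⟨x₁, ⟨hx₁, hx₁z⟩, hc₁⟩ :=
    exists_continuousAt_cdf_mem isOpen_Ioo (nonempty_Ioo.2 hx₀z) ν
  obtain ⟨x₂, ⟨hx₂, hx₂z⟩, hc₂⟩ :=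
    exists_continuousAt_cdf_mem isOpen_Ioo (nonempty_Ioo.2 hx₁z) ν
  have h₁ : 0 < cdf (ν : Measure ℝ) x₁ := hx₀.trans_le (monotone_cdf _ hx₁.le)
  have h₂ : cdf (ν : Measure ℝ) x₂ < 1 := hz x₂ ⟨hx₁.trans hx₂, hx₂z⟩
  -- `j` puts the level `1 - 1 / (j + 1)` strictly above `G x₂`; `y` is then taken where `G` exceeds
  -- `1 - 1 / (2 * (j + 1))`.
  obtain ⟨j, hj⟩ := exists_nat_one_div_lt (sub_pos.2 h₂)
  have hj0 : (0 : ℝ) < j + 1 := by positivity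
  obtain ⟨y₁, hy₁⟩ := eventually_atTop.1 ((tendsto_cdf_atTop (ν : Measure ℝ)).eventually_const_lt
    (sub_lt_self (1 : ℝ) (by positivity : (0 : ℝ) < 1 / (2 * (j + 1)))))
  obtain ⟨y, hy, hcy⟩ := exists_continuousAt_cdf_mem isOpen_Ioi (nonempty_Ioi (a := y₁)) ν
  have hev := (((hlim x₁ hc₁).eventually_const_lt h₁).and
    ((hlim x₂ hc₂).eventually_lt_const (lt_sub_comm.1 hj))).and
    ((hlim y hcy).eventually_const_lt (hy₁ y (le_of_lt hy)))
  obtain ⟨N₀, hN₀⟩ := eventually_atTop.1 hev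
  obtain ⟨k₀, hk₀⟩ := exists_nat_ge ((y - x₂) / (x₂ - x₁))
  -- The index has two roles: `N ≥ N₀` makes the limit inequalities hold at `N`, and `k₀` bounds the
  -- ratio `(y - x₂) / (x₂ - x₁)`.
  refine ⟨j, max N₀ k₀, ?_⟩
  rintro ⟨N, hkN, hN, u, w, v, huwv, hu, hw, hv⟩
  have hn0 : (0 : ℝ) < N := by exact_mod_cast hN
  have haN := ha N hN
  obtain ⟨⟨e₁, e₂⟩, e₃⟩ := hN₀ N ((le_max_left _ _).trans hkN)
  have hmono := monotone_cdf (freeMaxPow μ N : Measure ℝ)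
  have hu' : cdf (freeMaxPow μ N : Measure ℝ) u = 0 := by
    rw [cdf_freeMaxPow _ _ hN, one_sub_cdf_eq_real_Ioi]
    rw [div_lt_iff₀ hn0] at hu
    exact max_eq_left (by linarith)
  have hw' : 1 - 1 / ((j : ℝ) + 1) ≤ cdf (freeMaxPow μ N : Measure ℝ) w := by
    rw [cdf_freeMaxPow _ _ hN]
    refine le_max_of_le_right ?_
    have h : (μ : Measure ℝ).real (Iio w) ≤ cdf (μ : Measure ℝ) w := by
      rw [cdf_eq_real]
      exact measureReal_mono Iio_subset_Iic_self
    push_cast at hw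
    have h' : 1 - cdf (μ : Measure ℝ) w ≤ 1 / ((j + 1) * N) := by linarith
    have h'' := mul_le_mul_of_nonneg_left h' hn0.le
    have : (N : ℝ) * (1 / ((j + 1) * N)) = 1 / (j + 1) := by field_simp
    linarith
  have hv' : cdf (freeMaxPow μ N : Measure ℝ) v ≤ 1 - 1 / (2 * ((j : ℝ) + 1)) := by
    rw [cdf_freeMaxPow _ _ hN, one_sub_cdf_eq_real_Ioi]
    push_cast at hv
    refine max_le ?_ ?_
    · rw [sub_nonneg, div_le_one (by positivity)]
      linarith [(Nat.cast_nonneg j : (0 : ℝ) ≤ j)]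
    · have h'' := mul_le_mul_of_nonneg_left hv.le hn0.le
      have : (N : ℝ) * (1 / (2 * (j + 1) * N)) = 1 / (2 * (j + 1)) := by field_simp
      linarith
  -- Comparing values of the monotone `N`-th power gives `w - u > a N * (x₂ - x₁)` and `v - w < a N
  -- * (y - x₂)`, which contradicts the long gap.
  have l₁ : u < a N * x₁ + b N := hmono.reflect_lt (hu'.trans_lt e₁)
  have l₂ : a N * x₂ + b N < w := hmono.reflect_lt (e₂.trans_le hw')
  have l₃ : v < a N * y + b N := hmono.reflect_lt (hv'.trans_lt e₃)
  have hxx : 0 < x₂ - x₁ := sub_pos.2 hx₂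
  have hk : y - x₂ ≤ (max N₀ k₀ : ℕ) * (x₂ - x₁) :=
    (div_le_iff₀ hxx).1 (hk₀.trans (Nat.cast_le.2 (le_max_right _ _)))
  have hlow : (max N₀ k₀ : ℕ) * (a N * (x₂ - x₁)) ≤ ((max N₀ k₀ : ℕ) : ℝ) * (w - u) := by
    gcongr
    linarith
  have hscale := mul_le_mul_of_nonneg_left hk haN.le
  linarith

theorem isMeagre_freeMaxDomain : IsMeagre freeMaxDomain := by
  have h : ⋂ i : ℕ × ℕ, tailGapLaws (i.1 + 1) i.2 ∈ residual (ProbabilityMeasure ℝ) :=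
    countable_iInter_mem.2 fun i =>
      residual_of_dense_open (isOpen_tailGapLaws _ _) (dense_tailGapLaws _ _)
  refine mem_of_superset h fun μ hμ hmem => ?_
  obtain ⟨j, k, hjk⟩ := exists_notMem_tailGapLaws hmem
  exact hjk (mem_iInter.1 hμ (j, k))

theorem corollary1p3 : Dense freeMaxDomain ∧ IsMeagre freeMaxDomain :=
  ⟨dense_freeMaxDomain, isMeagre_freeMaxDomain⟩
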